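/- Let $G=(V,E)$ be a connected, non-bipartite, simple (unweighted) graph, finite or infinite, that is regular of some finite degree $d$. For $x\in V$ write $w(x)$ for the degree of $x$ (so $w(x)=d$), let $\ell^2(V,w)$ be the Hilbert space of functions $f:V\to\mathbb C$ with inner product $\langle f,g\rangle_w=\sum_{x\in V}w(x)f(x)\overline{g(x)}$, and let $P$ be the transition operator of simple random walk, $(Pf)(x)=\frac1{w(x)}\sum_{y\sim x}f(y)$. Let $Q=I+P$ be the probabilistic signless Laplacian, a bounded self-adjoint operator on $\ell^2(V,w)$, and let $I_Q$ be its resolution of identity (so $I_Q(S)=\mathbf 1_S(Q)$ is the spectral projection of $Q$ on $S$). The vertex spectral measure of $Q$ at $x$ is $$\mu_x^Q(\delta)=\bigl\langle I_Q([0,\delta])e_x,e_x\bigr\rangle_w,\qquad e_x=\frac{\mathbf 1_x}{\sqrt{w(x)}} .$$ Then $$\mu_x^Q(\delta)\le 10\sqrt{\delta}\qquad\text{for all } x\in V \text{ and } 0\le\delta\le 2 .$$ Moreover, if $G$ is finite with $n=|V|$ vertices, then $P$ and $Q$ each have $n$ real eigenvalues counted with multiplicity, and if these are listed in nondecreasing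 order as $\lambda^P_1\le\dots\le\lambda^P_n$ and $\lambda^Q_1\le\dots\le\lambda^Q_n$, then for all $1\le k\le n$ $$\lambda^Q_k\ge\frac{k^2}{100n^2}\qquad\text{and}\qquad \lambda^P_k\ge-1+\frac{k^2}{100n^2} .$$ -/

import Mathlib

open MeasureTheory
open scoped ENNReal

/-! ### Spectral projections of bounded self-adjoint operators -/

section SpectralProjection

variable {H : Type*} [NormedAddCommGroup H] [InnerProductSpace ℂ H] [CompleteSpace H]

/-- For a bounded self-adjoint operator `T` and a closed set `S` of reals, the spectral subspace
of `T` over `S`: the vectors annihilated by `f(T)` (continuous functional calculus) for every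
continuous `f : ℝ → ℝ` that vanishes on `S`. It is the range of `1_S(T)`. -/
noncomputable def spectralSubspace (T : H →L[ℂ] H) (S : Set ℝ) : Submodule ℂ H :=
  ⨅ f : {f : ℝ → ℝ // Continuous f ∧ ∀ s ∈ S, f s = 0}, (cfc f.1 T : H →L[ℂ] H).ker

theorem isClosed_spectralSubspace (T : H →L[ℂ] H) (S : Set ℝ) :
    IsClosed (spectralSubspace T S : Set H) := by
  unfold spectralSubspace
  rw [Submodule.coe_iInf]
  exact isClosed_iInter fun f => ContinuousLinearMap.isClosed_ker _

instance completeSpace_spectralSubspace (T : H →L[ℂ] H) (S : Set ℝ) :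
    CompleteSpace (spectralSubspace T S) :=
  (isClosed_spectralSubspace T S).completeSpace_coe

/-- The resolution of identity `I_T` of a bounded self-adjoint operator `T`, evaluated at a closed
set `S`: the spectral projection `I_T(S) = 1_S(T)`, i.e. the orthogonal projection onto the
spectral subspace of `T` over `S`. -/
noncomputable def spectralProjection (T : H →L[ℂ] H) (S : Set ℝ) : H →L[ℂ] H :=
  (spectralSubspace T S).starProjection

end SpectralProjection

namespace SimpleGraph

variable {V : Type*} (G : SimpleGraph V)

/-! ### The Hilbert space `ℓ²(V, w)`, where `w x` is the degree of `x` -/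

section Operators

variable [G.LocallyFinite]

/-- The measure `∑ x, w(x) δ_x` on the vertex set (all subsets are measurable). -/
noncomputable def vertexMeasure : @Measure V ⊤ :=
  @Measure.sum V V ⊤ fun x =>
    (G.degree x : ℝ≥0∞) • @Measure.dirac V ⊤ x

/-- The complex Hilbert space `ℓ²(V, w)`, with inner product `∑ x, w(x) (conj (f x)) (g x)`. -/
abbrev WeightedL2 : Type _ := Lp ℂ 2 G.vertexMeasure

theorem lintegral_vertexMeasure (f : V → ℝ≥0∞) :
    @lintegral V ⊤ G.vertexMeasure f = ∑' x, (G.degree x : ℝ≥0∞) * f x := by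
  let _ : MeasurableSpace V := ⊤
  unfold vertexMeasure
  rw [lintegral_sum_measure]
  congr 1; ext x
  rw [lintegral_smul_measure,
    lintegral_dirac' x (fun _ _ => trivial), smul_eq_mul]

theorem ae_vertexMeasure_iff (p : V → Prop) :
    (∀ᵐ x ∂ G.vertexMeasure, p x) ↔ ∀ x, G.degree x ≠ 0 → p x := by
  let _ : MeasurableSpace V := ⊤
  unfold vertexMeasure
  rw [Measure.ae_sum_iff' (MeasurableSpace.measurableSet_top : MeasurableSet[⊤] {x | p x})]
  refine forall_congr' fun x => ?_
  by_cases h : G.degree x = 0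
  · simp [h]
  · have h' : (G.degree x : ℝ≥0∞) ≠ 0 := by exact_mod_cast h
    rw [ae_iff, Measure.smul_apply, smul_eq_mul, mul_eq_zero,
      Measure.dirac_apply' x (MeasurableSpace.measurableSet_top : MeasurableSet[⊤] _)]
    simp [h', h]

/-! ### The transition operator and the probabilistic signless Laplacian -/

open Classical in
/-- The transition matrix `P` of simple random walk: `P(x, y) = 1 / w(x)` if `x` and `y` are
adjacent, and `0` otherwise. -/
noncomputable def transitionMatrix : Matrix V V ℝ :=
  Matrix.of fun x y => if G.Adj x y then 1 / (G.degree x : ℝ) else 0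

/-- `(P f)(x) = ∑_{y ∼ x} P(x, y) f(y)` on arbitrary functions. -/
noncomputable def transitionFun (f : V → ℂ) (x : V) : ℂ :=
  ∑ y ∈ G.neighborFinset x, (G.transitionMatrix x y : ℂ) * f y

theorem transitionFun_eq (f : V → ℂ) (x : V) :
    G.transitionFun f x = (G.degree x : ℂ)⁻¹ * ∑ y ∈ G.neighborFinset x, f y := by
  unfold transitionFun
  rw [Finset.mul_sum]
  refine Finset.sum_congr rfl fun y hy => ?_
  have : G.Adj x y := by simpa using hy
  simp [transitionMatrix, this]

theorem tsum_degree_mul (a : V → ℝ≥0∞) :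
    ∑' x, ∑ y ∈ G.neighborFinset x, a y = ∑' y, (G.degree y : ℝ≥0∞) * a y := by
  classical
  have h1 : ∀ x, ∑ y ∈ G.neighborFinset x, a y = ∑' y, if G.Adj x y then a y else 0 := by
    intro x
    rw [tsum_eq_sum (s := G.neighborFinset x)]
    · exact Finset.sum_congr rfl fun y hy => by
        rw [if_pos (by simpa using hy)]
    · intro y hy
      rw [if_neg (by simpa using hy)]
  simp_rw [h1]
  rw [ENNReal.tsum_comm]
  congr 1; ext y
  rw [tsum_eq_sum (s := G.neighborFinset y)]
  · rw [Finset.sum_congr rfl (g := fun _ => a y) fun x hx => by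
      rw [if_pos (G.adj_symm (by simpa using hx))]]
    simp
  · intro x hx
    rw [if_neg fun h => hx (by simpa using G.adj_symm h)]

theorem degree_mul_sq_transitionFun_le (f : V → ℂ) (x : V) :
    (G.degree x : ℝ≥0∞) * ‖G.transitionFun f x‖ₑ ^ (2 : ℝ) ≤
      ∑ y ∈ G.neighborFinset x, ‖f y‖ₑ ^ (2 : ℝ) := by
  have key : (G.degree x : ℝ) * ‖G.transitionFun f x‖ ^ 2 ≤
      ∑ y ∈ G.neighborFinset x, ‖f y‖ ^ 2 := by
    rw [transitionFun_eq, norm_mul, norm_inv, Complex.norm_natCast, mul_pow]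
    have h1 : ‖∑ y ∈ G.neighborFinset x, f y‖ ^ 2 ≤
        (G.degree x : ℝ) * ∑ y ∈ G.neighborFinset x, ‖f y‖ ^ 2 := by
      refine (pow_le_pow_left₀ (norm_nonneg _) (norm_sum_le _ _) 2).trans ?_
      rw [← G.card_neighborFinset_eq_degree]
      exact sq_sum_le_card_mul_sum_sq
    rcases Nat.eq_zero_or_pos (G.degree x) with h | h
    · simp only [h]
      simp
      positivity
    · have hd : (0 : ℝ) < G.degree x := by exact_mod_cast h
      calc (G.degree x : ℝ) * ((G.degree x : ℝ)⁻¹ ^ 2 * ‖∑ y ∈ G.neighborFinset x, f y‖ ^ 2)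
          ≤ (G.degree x : ℝ) * ((G.degree x : ℝ)⁻¹ ^ 2 *
              ((G.degree x : ℝ) * ∑ y ∈ G.neighborFinset x, ‖f y‖ ^ 2)) := by gcongr
        _ = _ := by field_simp
  have conv : ∀ z : ℂ, ‖z‖ₑ ^ (2 : ℝ) = ENNReal.ofReal (‖z‖ ^ 2) := by
    intro z
    rw [← ofReal_norm, ENNReal.ofReal_rpow_of_nonneg (norm_nonneg _) (by norm_num)]
    simp
  simp_rw [conv]
  rw [← ENNReal.ofReal_sum_of_nonneg (fun _ _ => by positivity), ← ENNReal.ofReal_natCast,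
    ← ENNReal.ofReal_mul (by positivity)]
  exact ENNReal.ofReal_le_ofReal key

theorem eLpNorm_transitionFun_le (f : V → ℂ) :
    eLpNorm (G.transitionFun f) 2 G.vertexMeasure ≤
      eLpNorm f 2 G.vertexMeasure := by
  rw [eLpNorm_eq_lintegral_rpow_enorm_toReal (by norm_num) (by norm_num),
    eLpNorm_eq_lintegral_rpow_enorm_toReal (by norm_num) (by norm_num),
    lintegral_vertexMeasure, lintegral_vertexMeasure]
  refine ENNReal.rpow_le_rpow ?_ (by positivity)
  rw [← G.tsum_degree_mul fun y => ‖f y‖ₑ ^ (2 : ℝ≥0∞).toReal]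
  exact ENNReal.tsum_le_tsum fun x => G.degree_mul_sq_transitionFun_le f x

theorem memLp_transitionFun {f : V → ℂ} (hf : MemLp f 2 G.vertexMeasure) :
    MemLp (G.transitionFun f) 2 G.vertexMeasure := by
  let _ : MeasurableSpace V := ⊤
  have hm : Measurable (G.transitionFun f) := fun _ _ => trivial
  exact ⟨hm.aestronglyMeasurable, (G.eLpNorm_transitionFun_le f).trans_lt hf.2⟩

theorem transitionFun_congr_ae {f g : V → ℂ} (h : f =ᵐ[G.vertexMeasure] g) :
    G.transitionFun f = G.transitionFun g := by
  have h' := (G.ae_vertexMeasure_iff _).1 h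
  ext x
  refine Finset.sum_congr rfl fun y hy => ?_
  have hxy : G.Adj x y := by simpa using hy
  rw [h' y]
  exact ((G.degree_pos_iff_exists_adj y).2 ⟨x, hxy.symm⟩).ne'

/-- The transition operator `P` of simple random walk, on `ℓ²(V, w)`. -/
noncomputable def transitionOp : G.WeightedL2 →L[ℂ] G.WeightedL2 :=
  LinearMap.mkContinuous
    { toFun := fun f => (G.memLp_transitionFun (Lp.memLp f)).toLp _
      map_add' := fun f g => by
        rw [← MemLp.toLp_add]
        refine MemLp.toLp_congr _ _ (Filter.Eventually.of_forall fun x => ?_)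
        rw [G.transitionFun_congr_ae (Lp.coeFn_add f g)]
        simp [transitionFun, mul_add, Finset.sum_add_distrib]
      map_smul' := fun c f => by
        rw [RingHom.id_apply, ← MemLp.toLp_const_smul]
        refine MemLp.toLp_congr _ _ (Filter.Eventually.of_forall fun x => ?_)
        rw [G.transitionFun_congr_ae (Lp.coeFn_smul c f)]
        simp [transitionFun, Finset.mul_sum, mul_left_comm] }
    1 fun f => by
      rw [one_mul]
      change ‖(G.memLp_transitionFun (Lp.memLp f)).toLp _‖ ≤ _
      rw [Lp.norm_toLp, Lp.norm_def]
      exact ENNReal.toReal_mono (Lp.eLpNorm_ne_top f)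
        (G.eLpNorm_transitionFun_le f)

/-- The probabilistic signless Laplacian `Q = I + P`, on `ℓ²(V, w)`. -/
noncomputable def signlessLaplacian : G.WeightedL2 →L[ℂ] G.WeightedL2 :=
  ContinuousLinearMap.id ℂ G.WeightedL2 + G.transitionOp

theorem hasSum_inner (f g : G.WeightedL2) :
    HasSum (fun x => (G.degree x : ℂ) * inner ℂ (f x) (g x)) (inner ℂ f g) := by
  let _ : MeasurableSpace V := ⊤
  have h : Integrable (fun x => inner ℂ (f x) (g x)) G.vertexMeasure := L2.integrable_inner f g
  have h2 := hasSum_integral_measure h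
  have h3 : ∀ x, ∫ y, inner ℂ (f y) (g y) ∂((G.degree x : ℝ≥0∞) • Measure.dirac x) =
      (G.degree x : ℂ) * inner ℂ (f x) (g x) := by
    intro x
    rw [integral_smul_measure, integral_dirac]
    simp
  rw [L2.inner_def]
  simp_rw [h3] at h2
  exact h2

theorem transitionOp_apply (f : G.WeightedL2) {x : V} (hx : G.degree x ≠ 0) :
    G.transitionOp f x = G.transitionFun f x :=
  (G.ae_vertexMeasure_iff _).1 (MemLp.coeFn_toLp (G.memLp_transitionFun (Lp.memLp f))) x hx

theorem summable_degree_mul_norm_sq (f : G.WeightedL2) :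
    Summable fun x => (G.degree x : ℝ) * ‖f x‖ ^ 2 := by
  have h := (G.hasSum_inner f f).summable.norm
  refine h.congr fun x => ?_
  simp [sq]

theorem isSelfAdjoint_transitionOp : IsSelfAdjoint G.transitionOp := by
  classical
  rw [ContinuousLinearMap.isSelfAdjoint_iff_isSymmetric]
  intro f g
  let F : V × V → ℂ := fun p => if G.Adj p.1 p.2 then inner ℂ (f p.2) (g p.1) else 0
  have hL1 : ∀ (a : V → ℂ) (x : V), HasSum (fun y => if G.Adj x y then a y else 0)
      (∑ y ∈ G.neighborFinset x, a y) := by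
    intro a x
    have : ∑ y ∈ G.neighborFinset x, a y =
        ∑ y ∈ G.neighborFinset x, if G.Adj x y then a y else 0 :=
      Finset.sum_congr rfl fun y hy => by rw [if_pos (by simpa using hy)]
    rw [this]
    exact hasSum_sum_of_ne_finset_zero fun y hy => by rw [if_neg (by simpa using hy)]
  have hR1 : ∀ (a : V → ℝ) (x : V), HasSum (fun y => if G.Adj x y then a y else 0)
      (∑ y ∈ G.neighborFinset x, a y) := by
    intro a x
    have : ∑ y ∈ G.neighborFinset x, a y =
        ∑ y ∈ G.neighborFinset x, if G.Adj x y then a y else 0 :=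
      Finset.sum_congr rfl fun y hy => by rw [if_pos (by simpa using hy)]
    rw [this]
    exact hasSum_sum_of_ne_finset_zero fun y hy => by rw [if_neg (by simpa using hy)]
  have hsum1 : ∀ h : G.WeightedL2,
      Summable fun p : V × V => if G.Adj p.1 p.2 then ‖h p.1‖ ^ 2 else 0 := by
    intro h
    rw [summable_prod_of_nonneg (fun p => by dsimp only; split_ifs <;> positivity)]
    refine ⟨fun x => (hR1 (fun _ => ‖h x‖ ^ 2) x).summable, ?_⟩
    refine (G.summable_degree_mul_norm_sq h).congr fun x => ?_
    rw [(hR1 (fun _ => ‖h x‖ ^ 2) x).tsum_eq]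
    simp
  have hsum2 : ∀ h : G.WeightedL2,
      Summable fun p : V × V => if G.Adj p.1 p.2 then ‖h p.2‖ ^ 2 else 0 := by
    intro h
    refine ((Equiv.prodComm V V).summable_iff.2 (hsum1 h)).congr fun p => ?_
    simp [G.adj_comm]
  have hF : Summable F := by
    refine Summable.of_norm_bounded ((hsum2 f).add (hsum1 g)) fun p => ?_
    simp only [F]
    split_ifs
    · refine (norm_inner_le_norm _ _).trans ?_
      nlinarith [sq_nonneg (‖f p.2‖ - ‖g p.1‖), sq_nonneg ‖f p.2‖, sq_nonneg ‖g p.1‖]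
    · simp
  have hd : ∀ x, (G.degree x : ℂ) ≠ 0 ∨ G.neighborFinset x = ∅ := by
    intro x
    by_cases h : G.degree x = 0
    · right; rwa [← Finset.card_eq_zero, G.card_neighborFinset_eq_degree]
    · left; exact_mod_cast h
  have e1 : ∀ x, (G.degree x : ℂ) * inner ℂ (G.transitionOp f x) (g x) =
      ∑ y ∈ G.neighborFinset x, inner ℂ (f y) (g x) := by
    intro x
    rcases hd x with h | h
    · rw [G.transitionOp_apply f (by exact_mod_cast h), transitionFun_eq, ← sum_inner]
      simp only [RCLike.inner_apply, map_mul, map_inv₀, map_natCast]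
      field_simp
    · have : G.degree x = 0 := by rw [← G.card_neighborFinset_eq_degree, h]; rfl
      simp [h, this]
  have e2 : ∀ x, (G.degree x : ℂ) * inner ℂ (f x) (G.transitionOp g x) =
      ∑ y ∈ G.neighborFinset x, inner ℂ (f x) (g y) := by
    intro x
    rcases hd x with h | h
    · rw [G.transitionOp_apply g (by exact_mod_cast h), transitionFun_eq, ← inner_sum]
      simp only [RCLike.inner_apply]
      field_simp
    · have : G.degree x = 0 := by rw [← G.card_neighborFinset_eq_degree, h]; rfl
      simp [h, this]
  have s1 := G.hasSum_inner (G.transitionOp f) g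
  have s2 := G.hasSum_inner f (G.transitionOp g)
  simp_rw [e1] at s1
  simp_rw [e2] at s2
  have t1 := hF.hasSum.prod_fiberwise fun x => hL1 (fun y => inner ℂ (f y) (g x)) x
  have t2 := ((Equiv.prodComm V V).hasSum_iff.2 hF.hasSum).prod_fiberwise
    (g := fun x => ∑ y ∈ G.neighborFinset x, inner ℂ (f x) (g y)) fun x => by
      refine (hL1 (fun y => inner ℂ (f x) (g y)) x).congr_fun fun y => ?_
      simp [F, G.adj_comm]
  exact (s1.unique t1).trans (t2.unique s2)

/-- `Q` is self-adjoint, so that its functional calculus is available. -/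
theorem isSelfAdjoint_signlessLaplacian : IsSelfAdjoint G.signlessLaplacian :=
  (IsSelfAdjoint.one (G.WeightedL2 →L[ℂ] G.WeightedL2)).add G.isSelfAdjoint_transitionOp

/-! ### The vertex spectral measure -/

theorem vertexMeasure_singleton_ne_top (x : V) : G.vertexMeasure {x} ≠ ∞ := by
  let _ : MeasurableSpace V := ⊤
  rw [← lintegral_indicator_one (MeasurableSpace.measurableSet_top : MeasurableSet[⊤] {x}),
    lintegral_vertexMeasure, tsum_eq_single x]
  · simp
  · intro y hy
    simp [hy]

/-- The vector `e_x = 1_x / √w(x)` of `ℓ²(V, w)`. -/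
noncomputable def vertexVector (x : V) : G.WeightedL2 :=
  indicatorConstLp 2 (MeasurableSpace.measurableSet_top : MeasurableSet[⊤] {x})
    (G.vertexMeasure_singleton_ne_top x) (((√(G.degree x : ℝ))⁻¹ : ℝ) : ℂ)

/-- The vertex spectral measure of `Q` at `x`: `μ_x^Q(δ) = ⟨I_Q([0, δ]) e_x, e_x⟩_w`. -/
noncomputable def vertexSpectralMeasure (x : V) (δ : ℝ) : ℝ :=
  RCLike.re (inner ℂ (spectralProjection G.signlessLaplacian (Set.Icc 0 δ) (G.vertexVector x))
    (G.vertexVector x))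

end Operators

end SimpleGraph

/-- `lam` lists the eigenvalues of the square matrix `M` over `ℝ` in nondecreasing order, each
repeated according to its multiplicity as a root of the characteristic polynomial; in particular,
`M` has `n` real eigenvalues counted with multiplicity. -/
def IsOrderedSpectrum {V : Type*} [Fintype V] [DecidableEq V] (M : Matrix V V ℝ)
    {n : ℕ} (lam : Fin n → ℝ) : Prop :=
  Monotone lam ∧ M.charpoly.roots = (Finset.univ : Finset (Fin n)).val.map lam

/-! Both halves rest on one inequality, `degree_mul_sq_sq_le`: a real function `h` whose mass `∑ d
h²` is at most `A`, and whose signless energy, summed over ordered adjacent pairs, is at most `2δA`,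
satisfies `(d h(x)²)² ≤ 100 δ A²` wherever `h x ≥ 0`.

Small signless energy makes `h` nearly alternate in sign along edges. An odd closed walk at `x`
prevents perfect alternation, so starting from `h x > 0` there is a shortest walk `v_0 = x, ...,
v_r` with `(-1)^r h(v_r) ≤ 0`. Put `c_i = max(0, (-1)^i h(v_i))`. Since `c_r = 0`, telescoping
`c_i²` and Cauchy-Schwarz give `c_0⁴ ≤ (energy on the walk) · 4 ∑ c_i²` (`pow_four_le_of_eq_zero`).

A constant free of `d` requires `d² ∑ c_i² = O(A)`, one factor `d` better than the trivial bound.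
Minimality provides it. A vertex has at most two neighbours of each parity on the walk
(`card_adj_le_two`), so the neighbourhoods of the walk overlap boundedly. Up to energy, each
`h(v_i)²` is dominated by its average over the neighbours of sign opposite to `(-1)^i`
(`degree_mul_sq_le`). This works when `δd ≤ 1`; otherwise the neighbourhood of `x` alone suffices.

For the spectral measure, `h` is the real part of the projection of `e_x`. For a finite graph, `h`
is the diagonal column at `x` of the projection onto the low eigenvectors; summing the resulting
bound over `x` counts eigenvalues. -/

namespace SimpleGraph

variable {V : Type*} (G : SimpleGraph V)

/-! ### Odd closed walks and minimal sign-changing walks -/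

/-- In a connected non-bipartite graph, every vertex lies on a closed walk of odd length. -/
theorem Connected.exists_odd_loop {G : SimpleGraph V} (hconn : G.Connected)
    (hnb : ¬ G.IsBipartite) (x : V) : ∃ p : G.Walk x x, Odd p.length := by
  have h := hnb
  rw [IsBipartite, two_colorable_iff_forall_loop_even] at h
  push Not at h
  obtain ⟨u, w, hw⟩ := h
  obtain ⟨q⟩ := hconn.preconnected x u
  refine ⟨(q.append w).append q.reverse, ?_⟩
  simp only [Walk.length_append, Walk.length_reverse]
  rw [Nat.not_even_iff_odd] at hw
  grind

theorem IsRegularOfDegree.pos_of_not_isBipartite {G : SimpleGraph V} [G.LocallyFinite] {d : ℕ}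
    (hreg : G.IsRegularOfDegree d) (hconn : G.Connected) (hnb : ¬ G.IsBipartite) : 0 < d := by
  obtain ⟨x⟩ := hconn.nonempty
  obtain ⟨p, hp⟩ := hconn.exists_odd_loop hnb x
  rw [← hreg.degree_eq x]
  exact (G.degree_pos_iff_exists_adj x).2 ⟨p.getVert 1, by simpa using p.adj_getVert_succ hp.pos⟩

/-- A walk from `x` of minimal length `r` for which the alternating sign `(-1)^r` turns the value
of `h` at the endpoint nonpositive. -/
structure IsMinSignWalk {G : SimpleGraph V} (h : V → ℝ) {x y : V} (p : G.Walk x y) : Prop where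
  nonpos : (-1) ^ p.length * h y ≤ 0
  pos_of_lt : ∀ (z : V) (q : G.Walk x z), q.length < p.length → 0 < (-1) ^ q.length * h z

/-- An odd closed walk at `x` turns `h x > 0` into a negative signed value, so the set of admissible
lengths is nonempty and has a least element. -/
theorem exists_isMinSignWalk {G : SimpleGraph V} (hconn : G.Connected)
    (hnb : ¬ G.IsBipartite) (h : V → ℝ) (x : V) (hx : 0 < h x) :
    ∃ (y : V) (p : G.Walk x y), IsMinSignWalk h p := by
  classical
  have hex : ∃ r : ℕ, ∃ (y : V) (p : G.Walk x y), p.length = r ∧ (-1) ^ p.length * h y ≤ 0 := by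
    obtain ⟨p, hp⟩ := hconn.exists_odd_loop hnb x
    exact ⟨_, x, p, rfl, by rw [hp.neg_one_pow]; linarith⟩
  obtain ⟨y, p, hp, hle⟩ := Nat.find_spec hex
  refine ⟨y, p, hle, fun z q hq => ?_⟩
  rw [hp] at hq
  have := Nat.find_min hex hq
  push Not at this
  exact this z q rfl

namespace IsMinSignWalk

variable {G} {h : V → ℝ} {x y : V} {p : G.Walk x y}

theorem pos (hp : IsMinSignWalk h p) {i : ℕ} (hi : i < p.length) :
    0 < (-1) ^ i * h (p.getVert i) := by
  have hl : (p.take i).length = i := by rw [Walk.take_length]; omega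
  have := hp.pos_of_lt _ (p.take i) (by omega)
  rwa [hl] at this

/-- Two vertices of a minimal walk cannot be joined by a shorter walk of the same parity. -/
theorem sub_le_length (hp : IsMinSignWalk h p) {i j : ℕ} (hij : i ≤ j) (hj : j ≤ p.length)
    (q : G.Walk (p.getVert i) (p.getVert j)) (hq : Even (i + j + q.length)) :
    j ≤ i + q.length := by
  by_contra hlt
  have h1 : (p.take i).length = i := by rw [Walk.take_length]; omega
  have h2 : (p.drop j).length = p.length - j := by rw [Walk.drop_length]
  have hlen : (((p.take i).append q).append (p.drop j)).length
      = i + q.length + (p.length - j) := by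
    simp only [Walk.length_append, h1, h2]
  have h3 := hp.pos_of_lt _ (((p.take i).append q).append (p.drop j)) (by omega)
  -- The parity hypothesis on `q` is used here: the spliced walk ends at the same `y` with the same
  -- sign, so being shorter it would contradict minimality.
  have h4 : (-1 : ℝ) ^ (i + q.length + (p.length - j)) = (-1) ^ p.length := by
    apply neg_one_pow_congr
    grind
  rw [hlen, h4] at h3
  exact absurd hp.nonpos (not_le.2 h3)

/-- A repetition at indices of opposite parity would make `h` both positive and negative at that
vertex. -/
theorem even_add (hp : IsMinSignWalk h p) {i j : ℕ} (hi : i < p.length) (hj : j < p.length)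
    (he : p.getVert i = p.getVert j) : Even (i + j) := by
  have h1 := hp.pos hi
  have h2 := hp.pos hj
  rw [he] at h1
  by_contra ho
  rw [Nat.not_even_iff_odd] at ho
  have : (-1 : ℝ) ^ i * (-1) ^ j = -1 := by rw [← pow_add, ho.neg_one_pow]
  have h3 := mul_pos h1 h2
  have h4 : (-1) ^ i * h (p.getVert j) * ((-1) ^ j * h (p.getVert j))
    = ((-1) ^ i * (-1) ^ j) * (h (p.getVert j)) ^ 2 := by ring
  rw [h4, this] at h3
  nlinarith [sq_nonneg (h (p.getVert j))]

/-- A repetition at indices of equal parity bounds a closed subwalk of even length, which could be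
cut out. Injectivity lets the energy along the walk be counted once per vertex. -/
theorem getVert_injOn (hp : IsMinSignWalk h p) :
    Set.InjOn p.getVert (Finset.range p.length : Set ℕ) := by
  have key : ∀ i j, i ≤ j → j < p.length → p.getVert i = p.getVert j → i = j := by
    intro i j hij hj he
    have h1 := hp.even_add (hij.trans_lt hj) hj he
    have h2 := hp.sub_le_length hij hj.le (Walk.nil.copy rfl he) (by simpa using h1)
    simp at h2
    omega
  intro i hi j hj he
  simp only [Finset.coe_range, Set.mem_Iio] at hi hj
  rcases le_total i j with hij | hij
  · exact key i j hij hj he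
  · exact (key j i hij hi he.symm).symm

/-- A vertex is adjacent to at most two vertices of a minimal walk of each parity. -/
theorem card_adj_le_two [DecidableRel G.Adj] (hp : IsMinSignWalk h p) (u : V) (b : ℕ) :
    ((Finset.range p.length).filter
      fun i => G.Adj (p.getVert i) u ∧ i % 2 = b).card ≤ 2 := by
  set T := (Finset.range p.length).filter fun i => G.Adj (p.getVert i) u ∧ i % 2 = b with hT
  have hdist : ∀ i ∈ T, ∀ j ∈ T, i ≤ j → j = i ∨ j = i + 2 := by
    intro i hi j hj hij
    simp only [hT, Finset.mem_filter, Finset.mem_range] at hi hj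
    -- The detour through `u` has length two, hence preserves parity; so `j ≤ i + 2`.
    have h2 := hp.sub_le_length hij hj.1.le (Walk.cons hi.2.1 (Walk.cons hj.2.1.symm Walk.nil))
      (by simp only [Walk.length_cons, Walk.length_nil]; grind)
    simp only [Walk.length_cons, Walk.length_nil] at h2
    omega
  rcases T.eq_empty_or_nonempty with h0 | h0
  · simp [h0]
  · refine (Finset.card_le_card (t := {T.min' h0, T.min' h0 + 2}) fun j hj => ?_).trans
      Finset.card_le_two
    rw [Finset.mem_insert, Finset.mem_singleton]
    exact hdist _ (T.min'_mem h0) j hj (T.min'_le j hj)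

/-- The neighbours of the vertices of a minimal walk, counted where `h` has the sign opposite to
that of the walk, carry at most twice the mass of `h`. -/
theorem sum_range_sum_neighborFinset_le [G.LocallyFinite] (hp : IsMinSignWalk h p) {B : ℝ}
    (hB : ∀ S : Finset V, ∑ u ∈ S, h u ^ 2 ≤ B) :
    ∑ i ∈ Finset.range p.length, ∑ u ∈ G.neighborFinset (p.getVert i),
      max 0 ((-1) ^ (i + 1) * h u) ^ 2 ≤ 2 * B := by
  classical
  set U := (Finset.range p.length).biUnion fun i => G.neighborFinset (p.getVert i) with hU
  have h1 : ∀ i ∈ Finset.range p.length, ∑ u ∈ G.neighborFinset (p.getVert i),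
      max 0 ((-1) ^ (i + 1) * h u) ^ 2 =
      ∑ u ∈ U, if G.Adj (p.getVert i) u then max 0 ((-1) ^ (i + 1) * h u) ^ 2 else 0 := by
    intro i hi
    rw [← Finset.sum_filter]
    refine Finset.sum_congr ?_ fun _ _ => rfl
    ext u
    simp only [Finset.mem_filter, mem_neighborFinset, hU, Finset.mem_biUnion]
    exact ⟨fun hu => ⟨⟨i, hi, hu⟩, hu⟩, fun hu => hu.2⟩
  rw [Finset.sum_congr rfl h1, Finset.sum_comm]
  have h2 : ∀ u, (∑ i ∈ Finset.range p.length,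
      if G.Adj (p.getVert i) u then max 0 ((-1) ^ (i + 1) * h u) ^ 2 else 0) ≤ 2 * h u ^ 2 := by
    intro u
    -- The sign of `h u` annihilates the terms of one parity class, so only the indices of parity
    -- `b` matter, and at most two of them are adjacent to `u`.
    have key : ∀ b : ℕ, (∀ i : ℕ, i % 2 ≠ b → max 0 ((-1) ^ (i + 1) * h u) = 0) →
        (∑ i ∈ Finset.range p.length,
          if G.Adj (p.getVert i) u then max 0 ((-1) ^ (i + 1) * h u) ^ 2 else 0)
            ≤ 2 * h u ^ 2 := by
      intro b hb
      have h3 : (∑ i ∈ Finset.range p.length,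
          if G.Adj (p.getVert i) u then max 0 ((-1) ^ (i + 1) * h u) ^ 2 else 0) ≤
          ∑ i ∈ (Finset.range p.length).filter
            (fun i => G.Adj (p.getVert i) u ∧ i % 2 = b), h u ^ 2 := by
        rw [Finset.sum_filter]
        refine Finset.sum_le_sum fun i _ => ?_
        by_cases ha : G.Adj (p.getVert i) u
        · by_cases hib : i % 2 = b
          · simp only [ha, hib, and_self, if_true]
            rcases neg_one_pow_eq_or ℝ (i + 1) with h5 | h5 <;> rw [h5] <;>
              rcases max_cases 0 (_ * h u) with h6 | h6 <;> rw [h6.1] <;>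
              nlinarith [sq_nonneg (h u)]
          · simp [ha, hib, hb i hib]
        · simp [ha]
      refine h3.trans ?_
      rw [Finset.sum_const, nsmul_eq_mul]
      have := hp.card_adj_le_two u b
      have h4 : (((Finset.range p.length).filter
        (fun i => G.Adj (p.getVert i) u ∧ i % 2 = b)).card : ℝ) ≤ 2 := by exact_mod_cast this
      exact mul_le_mul_of_nonneg_right h4 (sq_nonneg _)
    rcases le_total 0 (h u) with h0 | h0
    · refine key 1 fun i hi => ?_
      have : Odd (i + 1) := by grind
      rw [this.neg_one_pow]
      exact max_eq_left (by linarith)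
    · refine key 0 fun i hi => ?_
      have : Even (i + 1) := by grind
      rw [this.neg_one_pow]
      exact max_eq_left (by linarith)
  refine (Finset.sum_le_sum fun u _ => h2 u).trans ?_
  rw [← Finset.mul_sum]
  linarith [hB U]

end IsMinSignWalk

/-! ### The concentration inequality -/

/-- For `c_r = 0`, telescoping and Cauchy-Schwarz bound `c_0` by the energy and the mass of `c`. -/
theorem pow_four_le_of_eq_zero (c : ℕ → ℝ) (r : ℕ) (hr : c r = 0) :
    c 0 ^ 4 ≤ (∑ i ∈ Finset.range r, (c i - c (i + 1)) ^ 2) *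
      (4 * ∑ i ∈ Finset.range r, c i ^ 2) := by
  have h1 : ∑ i ∈ Finset.range r, (c i - c (i + 1)) * (c i + c (i + 1)) = c 0 ^ 2 := by
    have := Finset.sum_range_sub' (fun i => c i ^ 2) r
    simp only [hr] at this
    rw [Finset.sum_congr rfl (g := fun i => c i ^ 2 - c (i + 1) ^ 2) fun i _ => by ring, this]
    ring
  have h2 := Finset.sum_mul_sq_le_sq_mul_sq (Finset.range r)
    (fun i => c i - c (i + 1)) (fun i => c i + c (i + 1))
  rw [h1] at h2
  have h3 : ∑ i ∈ Finset.range r, (c i + c (i + 1)) ^ 2 ≤ 4 * ∑ i ∈ Finset.range r, c i ^ 2 := by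
    have h4 : ∑ i ∈ Finset.range r, c (i + 1) ^ 2 ≤ ∑ i ∈ Finset.range r, c i ^ 2 := by
      have h5 := Finset.sum_range_succ (fun i => c i ^ 2) r
      have h6 := Finset.sum_range_succ' (fun i => c i ^ 2) r
      simp only [hr] at h5
      nlinarith [sq_nonneg (c 0)]
    have h7 : ∑ i ∈ Finset.range r, (c i + c (i + 1)) ^ 2 ≤
        ∑ i ∈ Finset.range r, (2 * c i ^ 2 + 2 * c (i + 1) ^ 2) :=
      Finset.sum_le_sum fun i _ => by nlinarith [sq_nonneg (c i - c (i + 1))]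
    rw [Finset.sum_add_distrib, ← Finset.mul_sum, ← Finset.mul_sum] at h7
    linarith
  calc c 0 ^ 4 = (c 0 ^ 2) ^ 2 := by ring
    _ ≤ _ := h2
    _ ≤ _ := mul_le_mul_of_nonneg_left h3 (Finset.sum_nonneg fun _ _ => sq_nonneg _)

/-- For `s = ±1`, the square of `h v` is controlled by the part of `h` on the neighbours of `v`
of the sign opposite to `s`, and by the energy of the edges at `v`. -/
theorem degree_mul_sq_le [G.LocallyFinite] (h : V → ℝ) (v : V) {s : ℝ} (hs : s ^ 2 = 1)
    (hv : 0 ≤ s * h v) :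
    (G.degree v : ℝ) * h v ^ 2 ≤ 2 * (∑ u ∈ G.neighborFinset v, max 0 (-s * h u) ^ 2 +
      ∑ u ∈ G.neighborFinset v, (h v + h u) ^ 2) := by
  rw [← Finset.sum_add_distrib, Finset.mul_sum, ← G.card_neighborFinset_eq_degree,
    ← nsmul_eq_mul, ← Finset.sum_const]
  refine Finset.sum_le_sum fun u _ => ?_
  have h1 : h v ^ 2 = (s * h v) ^ 2 := by rw [mul_pow, hs, one_mul]
  have h2 : (h v + h u) ^ 2 = (s * h v - -s * h u) ^ 2 := by
    rw [show s * h v - -s * h u = s * (h v + h u) by ring, mul_pow, hs, one_mul]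
  rw [h1, h2]
  -- With `a = s * h v ≥ 0` and `b = -s * h u`: if `b ≤ 0` then `a² ≤ (a - b)²`, and otherwise `2b²
  -- + 2(a - b)² - a² = (a - 2b)²`.
  rcases max_cases 0 (-s * h u) with h3 | h3 <;> rw [h3.1]
  · nlinarith
  · nlinarith [sq_nonneg (s * h v - 2 * (-s * h u))]

/-- A function on a regular connected non-bipartite graph with small signless energy relative to
its mass cannot be concentrated at a vertex. -/
theorem degree_mul_sq_sq_le [G.LocallyFinite] {d : ℕ} (hreg : G.IsRegularOfDegree d)
    (hconn : G.Connected) (hnb : ¬ G.IsBipartite) (h : V → ℝ) (x : V) (hx : 0 ≤ h x) {A δ : ℝ}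
    (hδ : 0 ≤ δ) (hδ2 : δ ≤ 2) (hA : ∀ S : Finset V, ∑ y ∈ S, (d : ℝ) * h y ^ 2 ≤ A)
    (hE : ∀ S : Finset V, ∑ y ∈ S, ∑ u ∈ G.neighborFinset y, (h y + h u) ^ 2 ≤ 2 * δ * A) :
    ((d : ℝ) * h x ^ 2) ^ 2 ≤ 100 * δ * A ^ 2 := by
  classical
  have hA0 : 0 ≤ A := by simpa using hA ∅
  rcases hx.eq_or_lt with hx0 | hx0
  · rw [← hx0]; simp only [ne_eq, OfNat.ofNat_ne_zero, not_false_eq_true, zero_pow, mul_zero]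
    positivity
  obtain ⟨y, p, hp⟩ := exists_isMinSignWalk hconn hnb h x hx0
  have hr : 0 < p.length := by
    rcases Nat.eq_zero_or_pos p.length with h0 | h0
    · obtain rfl := Walk.eq_of_length_eq_zero h0
      have := hp.nonpos
      rw [h0] at this
      linarith
    · exact h0
  have hd : 0 < (d : ℝ) := by exact_mod_cast hreg.pos_of_not_isBipartite hconn hnb
  have hM := hp.sum_range_sum_neighborFinset_le (B := A / d) fun S => by
    rw [le_div_iff₀ hd, mul_comm, Finset.mul_sum]; exact hA S
  set M : ℕ → ℝ := fun i => ∑ u ∈ G.neighborFinset (p.getVert i),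
    max 0 ((-1) ^ (i + 1) * h u) ^ 2 with hMdef
  set E : ℕ → ℝ := fun i => ∑ u ∈ G.neighborFinset (p.getVert i), (h (p.getVert i) + h u) ^ 2
    with hEdef
  have hEs : ∑ i ∈ Finset.range p.length, E i ≤ 2 * δ * A := by
    refine le_trans (le_of_eq ?_) (hE ((Finset.range p.length).image p.getVert))
    rw [Finset.sum_image hp.getVert_injOn]
  have hME : ∀ i < p.length, (d : ℝ) * h (p.getVert i) ^ 2 ≤ 2 * (M i + E i) := by
    intro i hi
    have h1 := G.degree_mul_sq_le h (p.getVert i) (s := (-1) ^ i)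
      (by rw [← pow_mul, mul_comm, pow_mul]; simp) (hp.pos hi).le
    rw [hreg.degree_eq] at h1
    simpa only [hMdef, hEdef, pow_succ, mul_neg, mul_one] using h1
  have hE0 : ∀ i, 0 ≤ E i := fun i => Finset.sum_nonneg fun _ _ => sq_nonneg _
  -- The mass bound along the walk is `4A + 4(δd)A`, which is at most `8A` exactly in the range
  -- needed below. For `δd > 1` the term `A / d` is itself below `δA`, and no walk beyond `x` is
  -- needed.
  by_cases hdd : δ * d ≤ 1
  · set c : ℕ → ℝ := fun i => max 0 ((-1) ^ i * h (p.getVert i)) with hc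
    have hc0 : c 0 = h x := by simp [hc, hx]
    have h4 := pow_four_le_of_eq_zero c p.length (by
      simp only [hc, Walk.getVert_length]; exact max_eq_left hp.nonpos)
    have hdiff : ∑ i ∈ Finset.range p.length, (c i - c (i + 1)) ^ 2 ≤ 2 * δ * A := by
      refine le_trans (Finset.sum_le_sum fun i hi => ?_) hEs
      have hadj : p.getVert (i + 1) ∈ G.neighborFinset (p.getVert i) := by
        simpa using p.adj_getVert_succ (Finset.mem_range.1 hi)
      refine le_trans ?_ (Finset.single_le_sum
        (f := fun u => (h (p.getVert i) + h u) ^ 2) (fun _ _ => sq_nonneg _) hadj)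
      -- Truncation at `0` is 1-Lipschitz, and the alternating sign turns the difference of signed
      -- values into a sum of values of `h`.
      have h5 : |c i - c (i + 1)| ≤ |h (p.getVert i) + h (p.getVert (i + 1))| := by
        simp only [hc]
        refine (abs_max_sub_max_le_max _ _ _ _).trans ?_
        rw [sub_zero, abs_zero, max_eq_right (abs_nonneg _), pow_succ,
          show (-1 : ℝ) ^ i * h (p.getVert i) - (-1) ^ i * -1 * h (p.getVert (i + 1)) =
            (-1) ^ i * (h (p.getVert i) + h (p.getVert (i + 1))) by ring, abs_mul]
        simp
      exact sq_le_sq.2 h5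
    have hcs : (d : ℝ) ^ 2 * ∑ i ∈ Finset.range p.length, c i ^ 2 ≤ 8 * A := by
      have h6 : ∑ i ∈ Finset.range p.length, (d : ℝ) * c i ^ 2 ≤
          ∑ i ∈ Finset.range p.length, 2 * (M i + E i) := by
        refine Finset.sum_le_sum fun i hi => ?_
        have hi := Finset.mem_range.1 hi
        have : c i ^ 2 = h (p.getVert i) ^ 2 := by
          simp only [hc]
          rw [max_eq_right (hp.pos hi).le, mul_pow, ← pow_mul, mul_comm i, pow_mul]
          simp
        rw [this]
        exact hME i hi
      rw [← Finset.mul_sum, ← Finset.mul_sum, Finset.sum_add_distrib] at h6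
      have h7 : (d : ℝ) * ∑ i ∈ Finset.range p.length, c i ^ 2 ≤
          2 * (2 * (A / d) + 2 * δ * A) := by linarith
      have h8 := mul_le_mul_of_nonneg_left h7 hd.le
      have h9 : (d : ℝ) * (2 * (2 * (A / d) + 2 * δ * A)) = 4 * A + 4 * (δ * d) * A := by
        field_simp
        ring
      rw [h9] at h8
      nlinarith [mul_le_mul_of_nonneg_right hdd hA0]
    rw [hc0] at h4
    have hcn : 0 ≤ ∑ i ∈ Finset.range p.length, c i ^ 2 :=
      Finset.sum_nonneg fun _ _ => sq_nonneg _
    have hδA : 0 ≤ 2 * δ * A := by positivity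
    calc ((d : ℝ) * h x ^ 2) ^ 2 = (d : ℝ) ^ 2 * h x ^ 4 := by ring
      _ ≤ (d : ℝ) ^ 2 * ((2 * δ * A) * (4 * ∑ i ∈ Finset.range p.length, c i ^ 2)) := by
        gcongr
        exact h4.trans (mul_le_mul_of_nonneg_right hdiff (by positivity))
      _ = (2 * δ * A) * 4 * ((d : ℝ) ^ 2 * ∑ i ∈ Finset.range p.length, c i ^ 2) := by ring
      _ ≤ (2 * δ * A) * 4 * (8 * A) := by gcongr
      _ ≤ 100 * δ * A ^ 2 := by nlinarith [mul_nonneg hδ (sq_nonneg A)]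
  · push Not at hdd
    have h1 := hME 0 hr
    have h2 : E 0 ≤ 2 * δ * A :=
      (Finset.single_le_sum (f := E) (fun i _ => hE0 i) (Finset.mem_range.2 hr)).trans hEs
    have h3 : M 0 ≤ δ * A := by
      have h4 : M 0 ≤ ∑ u ∈ G.neighborFinset (p.getVert 0), h u ^ 2 := by
        refine Finset.sum_le_sum fun u _ => ?_
        rcases max_cases 0 ((-1) ^ (0 + 1) * h u) with h6 | h6 <;> rw [h6.1]
        · nlinarith [sq_nonneg (h u)]
        · simp
      have h5 := hA (G.neighborFinset (p.getVert 0))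
      rw [← Finset.mul_sum] at h5
      have h6 : d * M 0 ≤ d * (δ * A) := by nlinarith
      exact le_of_mul_le_mul_left h6 hd
    rw [Walk.getVert_zero] at h1
    -- `6 = 2 (1 + 2)`, from `M 0 ≤ δA` and `E 0 ≤ 2δA`. After squaring, `δ ≤ 2` trades one factor
    -- `δ` for a constant.
    have h7 : (d : ℝ) * h x ^ 2 ≤ 6 * (δ * A) := by linarith
    calc ((d : ℝ) * h x ^ 2) ^ 2 ≤ (6 * (δ * A)) ^ 2 := by gcongr
      _ = 36 * δ * (δ * A ^ 2) := by ring
      _ ≤ 36 * δ * (2 * A ^ 2) := by gcongr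
      _ ≤ 100 * δ * A ^ 2 := by nlinarith [mul_nonneg hδ (sq_nonneg A)]

end SimpleGraph

/-! ### The vertex spectral measure -/

/-- On the spectral subspace of `T` over `[0, δ]`, the quadratic form of `T` is at most `δ`. -/
theorem re_inner_le_of_mem_spectralSubspace {H : Type*} [NormedAddCommGroup H]
    [InnerProductSpace ℂ H] [CompleteSpace H] {T : H →L[ℂ] H} (hT : IsSelfAdjoint T) {δ : ℝ}
    {F : H} (hF : F ∈ spectralSubspace T (Set.Icc 0 δ)) :
    RCLike.re (inner ℂ F (T F)) ≤ δ * ‖F‖ ^ 2 := by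
  -- This function vanishes on `[0, δ]`, so `f(T)` kills `F`, while `s ≤ δ + f(s)` gives `T ≤ δ +
  -- f(T)`.
  set f : ℝ → ℝ := fun s => max (s - δ) 0 with hf
  have hfc : Continuous f := by fun_prop
  have hker : (cfc f T : H →L[ℂ] H) F = 0 := by
    unfold spectralSubspace at hF
    rw [Submodule.mem_iInf] at hF
    exact hF ⟨f, hfc, fun s hs => max_eq_right (by linarith [hs.2])⟩
  have h1 : T ≤ cfc (fun s => δ + f s) T := by
    conv_lhs => rw [← cfc_id' ℝ T]
    exact cfc_mono fun s _ => by
      have := le_max_left (s - δ) 0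
      simp only [hf]
      linarith
  rw [cfc_const_add δ f T, ContinuousLinearMap.le_def] at h1
  have h2 := h1.re_inner_nonneg_right F
  rw [sub_apply, add_apply, hker, add_zero, inner_sub_right,
    map_sub, Algebra.algebraMap_eq_smul_one, smul_apply,
    one_apply_eq_self, inner_smul_right_eq_smul, inner_self_eq_norm_sq_to_K] at h2
  have h3 : RCLike.re (δ • ((‖F‖ : ℂ) ^ 2)) = δ * ‖F‖ ^ 2 := by
    rw [← Complex.ofReal_pow, Complex.real_smul, ← Complex.ofReal_mul]
    exact Complex.ofReal_re _
  have h4 : RCLike.re (δ • ((‖F‖ : ℂ) ^ 2)) - RCLike.re (inner ℂ F (T F)) ≥ 0 := h2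
  linarith

namespace SimpleGraph

variable {V : Type*} (G : SimpleGraph V)

/-- Tonelli over adjacent pairs: each `y` is counted once for every neighbour. Nonnegativity allows
the passage through `ℝ≥0∞`. -/
theorem hasSum_sum_neighborFinset [G.LocallyFinite] {a : V → ℝ} (ha : ∀ x, 0 ≤ a x) {s : ℝ}
    (hs : HasSum (fun x => (G.degree x : ℝ) * a x) s) :
    HasSum (fun x => ∑ y ∈ G.neighborFinset x, a y) s := by
  have h1 := G.tsum_degree_mul fun y => ENNReal.ofReal (a y)
  have h2 : ∀ x, (G.degree x : ℝ≥0∞) * ENNReal.ofReal (a x) =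
      ENNReal.ofReal ((G.degree x : ℝ) * a x) := fun x => by
    rw [ENNReal.ofReal_mul (by positivity), ENNReal.ofReal_natCast]
  have hs0 : 0 ≤ s := hs.nonneg fun x => mul_nonneg (by positivity) (ha x)
  simp_rw [h2] at h1
  rw [← ENNReal.ofReal_tsum_of_nonneg (fun x => mul_nonneg (by positivity) (ha x)) hs.summable,
    hs.tsum_eq] at h1
  have h3 := ENNReal.hasSum_toReal (h1 ▸ ENNReal.ofReal_ne_top)
  rw [← ENNReal.tsum_toReal_eq fun x => ENNReal.sum_ne_top.2 fun _ _ => ENNReal.ofReal_ne_top, h1,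
    ENNReal.toReal_ofReal hs0] at h3
  refine h3.congr_fun fun x => ?_
  rw [← ENNReal.ofReal_sum_of_nonneg fun y _ => ha y,
    ENNReal.toReal_ofReal (Finset.sum_nonneg fun y _ => ha y)]

theorem hasSum_degree_mul_norm_sq [G.LocallyFinite] (F : G.WeightedL2) :
    HasSum (fun x => (G.degree x : ℝ) * ‖F x‖ ^ 2) (‖F‖ ^ 2) := by
  have h := (G.hasSum_inner F F).mapL Complex.reCLM
  have h1 : Complex.reCLM (inner ℂ F F) = ‖F‖ ^ 2 := (inner_self_eq_norm_sq (𝕜 := ℂ) F)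
  rw [h1] at h
  refine h.congr_fun fun x => ?_
  have h2 : (inner ℂ (F x) (F x)).re = ‖F x‖ ^ 2 := (inner_self_eq_norm_sq (𝕜 := ℂ) (F x))
  simp [← h2]

/-- The quadratic form of `Q` is the signless Dirichlet energy. -/
theorem hasSum_energy [G.LocallyFinite] (F : G.WeightedL2) :
    HasSum (fun x => ∑ y ∈ G.neighborFinset x, ‖F x + F y‖ ^ 2)
      (2 * RCLike.re (inner ℂ F (G.signlessLaplacian F))) := by
  have h1 := G.hasSum_degree_mul_norm_sq F
  have h2 := G.hasSum_sum_neighborFinset (fun x => sq_nonneg ‖F x‖) h1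
  have h3 := ((G.hasSum_inner F (G.transitionOp F)).mapL Complex.reCLM).mul_left 2
  have h4 : 2 * RCLike.re (inner ℂ F (G.signlessLaplacian F)) =
      ‖F‖ ^ 2 + ‖F‖ ^ 2 + 2 * Complex.reCLM (inner ℂ F (G.transitionOp F)) := by
    rw [signlessLaplacian, add_apply, ContinuousLinearMap.id_apply,
      inner_add_right, map_add, inner_self_eq_norm_sq]
    simp only [Complex.reCLM_apply, RCLike.re_to_complex]
    ring
  rw [h4]
  refine ((h1.add h2).add h3).congr_fun fun x => ?_
  have h5 : (G.degree x : ℂ) * inner ℂ (F x) (G.transitionOp F x) =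
      ∑ y ∈ G.neighborFinset x, inner ℂ (F x) (F y) := by
    by_cases h : G.degree x = 0
    · have h0 : G.neighborFinset x = ∅ := by
        rwa [← Finset.card_eq_zero, G.card_neighborFinset_eq_degree]
      simp [h, h0]
    · have : (G.degree x : ℂ) ≠ 0 := by exact_mod_cast h
      rw [G.transitionOp_apply F h, transitionFun_eq, ← inner_sum]
      simp only [RCLike.inner_apply]
      field_simp
  rw [h5, map_sum, Finset.mul_sum, ← G.card_neighborFinset_eq_degree, ← nsmul_eq_mul,
    ← Finset.sum_const, ← Finset.sum_add_distrib, ← Finset.sum_add_distrib]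
  refine Finset.sum_congr rfl fun y _ => ?_
  rw [norm_add_sq (𝕜 := ℂ)]
  simp only [Complex.reCLM_apply, RCLike.re_to_complex]
  ring

theorem inner_vertexVector [G.LocallyFinite] (F : G.WeightedL2) (x : V) :
    inner ℂ F (G.vertexVector x) = (√(G.degree x : ℝ) : ℂ) * (starRingEnd ℂ) (F x) := by
  have h := G.hasSum_inner F (G.vertexVector x)
  have hv : ∀ y, G.degree y ≠ 0 → G.vertexVector x y =
      Set.indicator {x} (fun _ => (((√(G.degree x : ℝ))⁻¹ : ℝ) : ℂ)) y :=
    (G.ae_vertexMeasure_iff _).1 indicatorConstLp_coeFn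
  have h2 := hasSum_single (f := fun y => (G.degree y : ℂ) * inner ℂ (F y) (G.vertexVector x y)) x
    fun y hy => by
      by_cases h0 : G.degree y = 0
      · simp [h0]
      · simp [hv y h0, hy]
  rw [h.unique h2]
  by_cases h0 : G.degree x = 0
  · simp [h0]
  · have h3 : (√(G.degree x : ℝ)) ≠ 0 := Real.sqrt_ne_zero'.2 (by positivity)
    have h4 : (G.degree x : ℂ) = (√(G.degree x : ℝ) : ℂ) * (√(G.degree x : ℝ) : ℂ) := by
      rw [← Complex.ofReal_mul, Real.mul_self_sqrt (by positivity)]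
      simp
    have h5 : (√(G.degree x : ℝ) : ℂ) ≠ 0 := by exact_mod_cast h3
    rw [hv x h0, Set.indicator_of_mem (Set.mem_singleton x), RCLike.inner_apply, h4,
      Complex.ofReal_inv]
    field_simp

/-- Write `μ` for the measure and `F` for the projection of `e_x`. Then `μ = ‖F‖² = √d Re F(x)`, so
the concentration inequality for `Re F` with `A = μ` reads `μ⁴ ≤ 100 δ μ²`. Taking real parts only
lowers mass and energy. -/
theorem vertexSpectralMeasure_le [G.LocallyFinite] {d : ℕ} (hreg : G.IsRegularOfDegree d)
    (hconn : G.Connected) (hnb : ¬ G.IsBipartite) (x : V) {δ : ℝ} (hδ : 0 ≤ δ) (hδ2 : δ ≤ 2) :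
    G.vertexSpectralMeasure x δ ≤ 10 * √δ := by
  set F := spectralProjection G.signlessLaplacian (Set.Icc 0 δ) (G.vertexVector x) with hF
  have hmem : F ∈ spectralSubspace G.signlessLaplacian (Set.Icc 0 δ) :=
    Submodule.starProjection_apply_mem _ _
  have hμ : G.vertexSpectralMeasure x δ = ‖F‖ ^ 2 := by
    have h1 : inner ℂ F (G.vertexVector x) = inner ℂ F F := by
      have := Submodule.starProjection_inner_eq_zero (K := spectralSubspace G.signlessLaplacian
        (Set.Icc 0 δ)) (G.vertexVector x) F hmem
      rw [← inner_conj_symm, map_eq_zero] at this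
      change inner ℂ F (G.vertexVector x - F) = 0 at this
      rwa [inner_sub_right, sub_eq_zero] at this
    rw [vertexSpectralMeasure, ← hF, h1, inner_self_eq_norm_sq]
  have hFx : G.vertexSpectralMeasure x δ = √(d : ℝ) * (F x).re := by
    rw [vertexSpectralMeasure, ← hF, inner_vertexVector, hreg.degree_eq]
    simp
  have hd : 0 < √(d : ℝ) := by
    rw [Real.sqrt_pos]
    exact_mod_cast hreg.pos_of_not_isBipartite hconn hnb
  have hre : ∀ z : ℂ, z.re ^ 2 ≤ ‖z‖ ^ 2 := fun z =>
    sq_le_sq.2 (by rw [abs_norm]; exact Complex.abs_re_le_norm z)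
  have hx0 : 0 ≤ (F x).re := by
    have : 0 ≤ √(d : ℝ) * (F x).re := by rw [← hFx, hμ]; positivity
    exact nonneg_of_mul_nonneg_right this hd
  have key := G.degree_mul_sq_sq_le hreg hconn hnb (fun y => (F y).re) x hx0 (A := ‖F‖ ^ 2) hδ hδ2
    (fun S => by
      refine le_trans (Finset.sum_le_sum fun y _ => ?_)
        (sum_le_hasSum S (fun _ _ => by positivity) (G.hasSum_degree_mul_norm_sq F))
      rw [hreg.degree_eq]
      exact mul_le_mul_of_nonneg_left (hre _) (by positivity))
    (fun S => by
      have h1 := sum_le_hasSum S (fun _ _ => by positivity) (G.hasSum_energy F)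
      have h2 := re_inner_le_of_mem_spectralSubspace G.isSelfAdjoint_signlessLaplacian hmem
      refine le_trans (Finset.sum_le_sum fun y _ => Finset.sum_le_sum fun u _ => ?_)
        (h1.trans (by linarith))
      rw [← Complex.add_re]
      exact hre _)
  set μ := G.vertexSpectralMeasure x δ
  have h1 : (d : ℝ) * (F x).re ^ 2 = μ ^ 2 := by
    rw [hFx, mul_pow, Real.sq_sqrt (by positivity)]
  have hμ0 : 0 ≤ μ := by rw [hμ]; positivity
  rw [h1, ← hμ] at key
  rcases hμ0.eq_or_lt with h0 | h0
  · rw [← h0]; positivity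
  · have h2 : μ ^ 2 ≤ 100 * δ := by
      have : μ ^ 2 * μ ^ 2 ≤ (100 * δ) * μ ^ 2 := by linarith [key, sq (μ ^ 2)]
      exact le_of_mul_le_mul_right this (by positivity)
    refine le_of_sq_le_sq (by
      rw [mul_pow, Real.sq_sqrt hδ]; linarith) (by positivity)

end SimpleGraph

/-! ### Eigenvalue bounds for finite graphs -/

namespace SimpleGraph

variable {V : Type*} (G : SimpleGraph V)

/-- Constant degree makes the transition matrix symmetric in the unweighted inner product. The
parameter `c` treats `Q` (`c = 1`) and `P` (`c = 0`) together. -/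
theorem IsRegularOfDegree.isHermitian_smul_one_add_transitionMatrix {G : SimpleGraph V}
    [G.LocallyFinite] [DecidableEq V] {d : ℕ} (hreg : G.IsRegularOfDegree d) (c : ℝ) :
    (c • (1 : Matrix V V ℝ) + G.transitionMatrix).IsHermitian := by
  ext x y
  by_cases h : G.Adj x y
  · simp [transitionMatrix, hreg.degree_eq, h, h.symm, Matrix.one_apply, eq_comm (a := y)]
  · simp [transitionMatrix, h, mt G.adj_symm h, Matrix.one_apply, eq_comm (a := y)]

theorem transitionMatrix_mulVec [G.LocallyFinite] [Fintype V] (h : V → ℝ) (x : V) :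
    (G.degree x : ℝ) * (G.transitionMatrix.mulVec h) x = ∑ y ∈ G.neighborFinset x, h y := by
  classical
  have h0 : ∀ y, (G.degree x : ℝ) * (G.transitionMatrix x y * h y) =
      if G.Adj x y then h y else 0 := by
    intro y
    by_cases ha : G.Adj x y
    · have : (G.degree x : ℝ) ≠ 0 := by
        exact_mod_cast ((G.degree_pos_iff_exists_adj x).2 ⟨y, ha⟩).ne'
      simp only [transitionMatrix, Matrix.of_apply, ha, if_true]
      field_simp
    · simp [transitionMatrix, ha]
  rw [Matrix.mulVec, dotProduct, Finset.mul_sum, Finset.sum_congr rfl fun y _ => h0 y,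
    ← Finset.sum_filter]
  exact Finset.sum_congr (by ext; simp) fun _ _ => rfl

theorem IsRegularOfDegree.sum_energy_eq {G : SimpleGraph V} [G.LocallyFinite] [Fintype V] {d : ℕ}
    (hreg : G.IsRegularOfDegree d) (h : V → ℝ) :
    ∑ x, ∑ y ∈ G.neighborFinset x, (h x + h y) ^ 2 =
      2 * d * ∑ x, h x * (h x + G.transitionMatrix.mulVec h x) := by
  have h1 : ∑ x, ∑ y ∈ G.neighborFinset x, h y ^ 2 = ∑ x, (d : ℝ) * h x ^ 2 := by
    have := G.hasSum_sum_neighborFinset (a := fun x => h x ^ 2) (fun _ => sq_nonneg _)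
      (hasSum_fintype _)
    rw [(hasSum_fintype _).unique this]
    exact Finset.sum_congr rfl fun x _ => by rw [hreg.degree_eq]
  have h2 : ∀ x, ∑ y ∈ G.neighborFinset x, (h x + h y) ^ 2 =
      d * h x ^ 2 + 2 * d * (h x * G.transitionMatrix.mulVec h x) +
        ∑ y ∈ G.neighborFinset x, h y ^ 2 := by
    intro x
    have h3 := G.transitionMatrix_mulVec h x
    have h4 : (G.degree x : ℝ) = d := by rw [hreg.degree_eq]
    have h5 : ∑ y ∈ G.neighborFinset x, h x ^ 2 = d * h x ^ 2 := by
      rw [Finset.sum_const, G.card_neighborFinset_eq_degree, nsmul_eq_mul, h4]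
    rw [h4] at h3
    calc _ = ∑ y ∈ G.neighborFinset x, (h x ^ 2 + 2 * h x * h y + h y ^ 2) :=
          Finset.sum_congr rfl fun y _ => by ring
      _ = _ := by
          rw [Finset.sum_add_distrib, Finset.sum_add_distrib, ← Finset.mul_sum, ← h3, h5]
          ring
  rw [Finset.sum_congr rfl fun x _ => h2 x, Finset.sum_add_distrib, h1, ← Finset.sum_add_distrib,
    Finset.mul_sum]
  exact Finset.sum_congr rfl fun x _ => by ring

section Spectrum

variable {G} [G.LocallyFinite] [Fintype V] [DecidableEq V] {d : ℕ} {c : ℝ}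

/-- Mass of a combination of eigenvectors. -/
theorem _root_.Matrix.IsHermitian.sum_sq_eigenvectors {M : Matrix V V ℝ} (hM : M.IsHermitian)
    (a : V → ℝ) :
    ∑ y, (∑ j, a j * hM.eigenvectorBasis j y) ^ 2 = ∑ j, a j ^ 2 := by
  have := hM.eigenvectorBasis.orthonormal.inner_sum a a Finset.univ
  simp only [PiLp.inner_apply, WithLp.ofLp_sum, Finset.sum_apply, WithLp.ofLp_smul, Pi.smul_apply,
    smul_eq_mul, RCLike.inner_apply, conj_trivial] at this
  simpa only [sq] using this

theorem _root_.Matrix.IsHermitian.sum_mul_mulVec_eigenvectors {M : Matrix V V ℝ}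
    (hM : M.IsHermitian) (a : V → ℝ) :
    ∑ y, (∑ j, a j * hM.eigenvectorBasis j y) *
      M.mulVec (fun y => ∑ j, a j * hM.eigenvectorBasis j y) y =
        ∑ j, hM.eigenvalues j * a j ^ 2 := by
  have h1 : M.mulVec (fun y => ∑ j, a j * hM.eigenvectorBasis j y) =
      fun y => ∑ j, (hM.eigenvalues j * a j) * hM.eigenvectorBasis j y := by
    have h2 : (fun y => ∑ j, a j * hM.eigenvectorBasis j y) =
        ∑ j, a j • (hM.eigenvectorBasis j : V → ℝ) := by
      ext y; simp
    rw [h2, Matrix.mulVec_sum]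
    ext y
    simp only [Matrix.mulVec_smul, hM.mulVec_eigenvectorBasis, Finset.sum_apply, Pi.smul_apply,
      smul_eq_mul]
    exact Finset.sum_congr rfl fun j _ => by ring
  have := hM.eigenvectorBasis.orthonormal.inner_sum a (fun j => hM.eigenvalues j * a j)
    Finset.univ
  simp only [PiLp.inner_apply, WithLp.ofLp_sum, Finset.sum_apply, WithLp.ofLp_smul, Pi.smul_apply,
    smul_eq_mul, RCLike.inner_apply, conj_trivial] at this
  rw [h1]
  calc _ = _ := Finset.sum_congr rfl fun y _ => mul_comm _ _
    _ = _ := this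
    _ = _ := Finset.sum_congr rfl fun j _ => by ring

theorem IsRegularOfDegree.sum_energy_eigenvectors (hreg : G.IsRegularOfDegree d)
    (hM : (c • (1 : Matrix V V ℝ) + G.transitionMatrix).IsHermitian) (a : V → ℝ) :
    ∑ x, ∑ y ∈ G.neighborFinset x, ((∑ j, a j * hM.eigenvectorBasis j x) +
      ∑ j, a j * hM.eigenvectorBasis j y) ^ 2 =
        2 * d * ∑ j, (hM.eigenvalues j + 1 - c) * a j ^ 2 := by
  set h : V → ℝ := fun y => ∑ j, a j * hM.eigenvectorBasis j y with hh
  have h0 := hreg.sum_energy_eq h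
  have h1 := hM.sum_sq_eigenvectors a
  have h2 := hM.sum_mul_mulVec_eigenvectors a
  rw [← hh] at h2
  have h3 : ∀ x, h x * (h x + G.transitionMatrix.mulVec h x) =
      h x * (c • (1 : Matrix V V ℝ) + G.transitionMatrix).mulVec h x + (1 - c) * h x ^ 2 := by
    intro x
    simp only [Matrix.add_mulVec, Matrix.smul_mulVec, Matrix.one_mulVec, Pi.add_apply,
      Pi.smul_apply, smul_eq_mul]
    ring
  rw [Finset.sum_congr rfl fun x _ => h3 x, Finset.sum_add_distrib, ← Finset.mul_sum] at h0
  refine h0.trans ?_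
  rw [h2, h1, Finset.mul_sum, ← Finset.sum_add_distrib]
  congr 1
  exact Finset.sum_congr rfl fun j _ => by ring

/-- The energy of a single eigenvector is nonnegative. -/
theorem IsRegularOfDegree.sub_one_le_eigenvalues (hreg : G.IsRegularOfDegree d) (hd : 0 < d)
    (hM : (c • (1 : Matrix V V ℝ) + G.transitionMatrix).IsHermitian) (j : V) :
    c - 1 ≤ hM.eigenvalues j := by
  have h := hreg.sum_energy_eigenvectors hM (Pi.single j 1)
  have h1 : ∑ i, (hM.eigenvalues i + 1 - c) * (Pi.single j 1 : V → ℝ) i ^ 2 =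
      hM.eigenvalues j + 1 - c := by
    rw [Finset.sum_eq_single j]
    · simp
    · intro i _ hi; simp [hi]
    · simp
  rw [h1] at h
  have h2 : (0 : ℝ) ≤ 2 * d * (hM.eigenvalues j + 1 - c) := by
    rw [← h]
    exact Finset.sum_nonneg fun _ _ => Finset.sum_nonneg fun _ _ => sq_nonneg _
  have h3 : (0 : ℝ) < 2 * d := by positivity
  linarith [nonneg_of_mul_nonneg_right h2 h3]

/-- The number of eigenvalues up to `lam` is controlled by the concentration bound. -/
theorem card_eigenvalues_le (hreg : G.IsRegularOfDegree d)
    (hconn : G.Connected) (hnb : ¬ G.IsBipartite) (hd : 0 < d)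
    (hM : (c • (1 : Matrix V V ℝ) + G.transitionMatrix).IsHermitian) {lam : ℝ}
    (h0 : 0 ≤ lam + 1 - c) (h2 : lam + 1 - c ≤ 2) :
    ((Finset.univ.filter fun j => hM.eigenvalues j ≤ lam).card : ℝ) ≤
      Fintype.card V * (10 * √(lam + 1 - c)) := by
  set J := Finset.univ.filter fun j => hM.eigenvalues j ≤ lam with hJ
  set δ := lam + 1 - c with hδ
  set b := hM.eigenvectorBasis
  have hd' : (0 : ℝ) < d := by exact_mod_cast hd
  have hx : ∀ x, ∑ j ∈ J, b j x ^ 2 ≤ 10 * √δ := by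
    intro x
    -- These are the coefficients of the projection of `1_x` onto the span of the eigenvectors in
    -- `J`; hence its value at `x` and its squared norm are both `m`.
    set a : V → ℝ := fun j => if j ∈ J then b j x else 0 with ha
    set m := ∑ j ∈ J, b j x ^ 2 with hm
    have hm0 : 0 ≤ m := Finset.sum_nonneg fun _ _ => sq_nonneg _
    have ham : ∑ j, a j ^ 2 = m := by
      simp [ha, hm, ite_pow]
    set h : V → ℝ := fun y => ∑ j, a j * b j y with hh
    have hhx : h x = m := by
      simp only [hh, ← ham]
      exact Finset.sum_congr rfl fun j _ => by simp only [ha]; split_ifs <;> ring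
    have key := G.degree_mul_sq_sq_le hreg hconn hnb h x (hhx ▸ hm0) (A := d * m) h0 h2
      (fun S => by
        refine (Finset.sum_le_univ_sum_of_nonneg fun _ => by positivity).trans (le_of_eq ?_)
        rw [← Finset.mul_sum, hM.sum_sq_eigenvectors, ham])
      (fun S => by
        refine (Finset.sum_le_univ_sum_of_nonneg fun _ => by positivity).trans ?_
        refine (hreg.sum_energy_eigenvectors hM a).trans_le ?_
        have : ∑ j, (hM.eigenvalues j + 1 - c) * a j ^ 2 ≤ δ * m := by
          rw [← ham, Finset.mul_sum]
          refine Finset.sum_le_sum fun j _ => ?_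
          by_cases hj : j ∈ J
          · have : hM.eigenvalues j ≤ lam := by simpa [hJ] using hj
            exact mul_le_mul_of_nonneg_right (by simp only [hδ]; linarith) (sq_nonneg _)
          · simp [ha, hj]
        calc _ ≤ 2 * d * (δ * m) := by gcongr
          _ = _ := by ring)
    rw [hhx] at key
    rcases hm0.eq_or_lt with hz | hz
    · rw [← hz]; positivity
    · have h4 : m ^ 2 * (d * m) ^ 2 ≤ (100 * δ) * (d * m) ^ 2 := by
        calc _ = (d * m ^ 2) ^ 2 := by ring
          _ ≤ _ := key
      have h5 : m ^ 2 ≤ 100 * δ := le_of_mul_le_mul_right h4 (by positivity)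
      refine le_of_sq_le_sq (by
        rw [mul_pow, Real.sq_sqrt h0]; linarith) (by positivity)
  -- The trace of the projection is `J.card`, so the pointwise bounds `hx` sum to the count.
  have hn : ∀ j, ∑ x, b j x ^ 2 = 1 := by
    intro j
    have := b.orthonormal.1 j
    rw [EuclideanSpace.norm_eq, Real.sqrt_eq_one] at this
    simpa using this
  calc (J.card : ℝ) = ∑ j ∈ J, ∑ x, b j x ^ 2 := by simp [hn]
    _ = ∑ x, ∑ j ∈ J, b j x ^ 2 := Finset.sum_comm
    _ ≤ ∑ x : V, 10 * √δ := Finset.sum_le_sum fun x _ => hx x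
    _ = _ := by simp

theorem exists_isOrderedSpectrum (hreg : G.IsRegularOfDegree d)
    (hconn : G.Connected) (hnb : ¬ G.IsBipartite) (c : ℝ) :
    ∃ lam : Fin (Fintype.card V) → ℝ,
      IsOrderedSpectrum (c • (1 : Matrix V V ℝ) + G.transitionMatrix) lam ∧
      ∀ k : Fin (Fintype.card V),
        c - 1 + ((k : ℝ) + 1) ^ 2 / (100 * (Fintype.card V : ℝ) ^ 2) ≤ lam k := by
  have hM := hreg.isHermitian_smul_one_add_transitionMatrix c
  have hd := hreg.pos_of_not_isBipartite hconn hnb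
  -- `eigenvalues₀` is decreasing, hence the reversal; `k` starts at `0`, hence `k + 1` in the
  -- bound.
  refine ⟨fun k => hM.eigenvalues₀ k.rev,
    ⟨fun i j hij => hM.eigenvalues₀_antitone (Fin.rev_le_rev.2 hij), ?_⟩, fun k => ?_⟩
  · rw [hM.roots_charpoly_eq_eigenvalues₀]
    have h1 : (Finset.univ : Finset (Fin (Fintype.card V))).val.map Fin.rev = Finset.univ.val :=
      Multiset.map_univ_val_equiv Fin.revPerm
    conv_lhs => rw [← h1, Multiset.map_map]
    rfl
  · set e : Fin (Fintype.card V) ≃ V := Fintype.equivOfCardEq (Fintype.card_fin _) with he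
    set lam := hM.eigenvalues₀ k.rev with hlam
    have hev : ∀ i, hM.eigenvalues (e i) = hM.eigenvalues₀ i := fun i => by
      simp [Matrix.IsHermitian.eigenvalues, he]
    have h0 : 0 ≤ lam + 1 - c := by
      have := hreg.sub_one_le_eigenvalues hd hM (e k.rev)
      rw [hev] at this
      linarith
    have hn0 : (0 : ℝ) < Fintype.card V := by exact_mod_cast k.pos
    have hkn : (k : ℝ) + 1 ≤ Fintype.card V := by exact_mod_cast k.2
    have goal : ((k : ℝ) + 1) ^ 2 / (100 * (Fintype.card V : ℝ) ^ 2) ≤ lam + 1 - c := by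
      rw [div_le_iff₀ (by positivity)]
      -- Beyond `2` the counting bound is unavailable, but `k + 1 ≤ n` already suffices, so no upper
      -- bound on the spectrum is needed.
      by_cases h2 : lam + 1 - c ≤ 2
      · have hc := card_eigenvalues_le hreg hconn hnb hd hM h0 h2
        have hcard : (k : ℕ) + 1 ≤
            (Finset.univ.filter fun j => hM.eigenvalues j ≤ lam).card := by
          have h3 : ((Finset.Ici k.rev).map e.toEmbedding).card = (k : ℕ) + 1 := by
            rw [Finset.card_map, Fin.card_Ici, Fin.val_rev]
            omega
          rw [← h3]
          refine Finset.card_le_card fun j hj => ?_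
          obtain ⟨i, hi, rfl⟩ := Finset.mem_map.1 hj
          simp only [Finset.mem_filter, Finset.mem_univ, true_and, Equiv.coe_toEmbedding, hev]
          exact hM.eigenvalues₀_antitone (Finset.mem_Ici.1 hi)
        have h4 : (k : ℝ) + 1 ≤ Fintype.card V * (10 * √(lam + 1 - c)) :=
          le_trans (by exact_mod_cast hcard) hc
        calc ((k : ℝ) + 1) ^ 2 ≤ (Fintype.card V * (10 * √(lam + 1 - c))) ^ 2 := by gcongr
          _ = (lam + 1 - c) * (100 * (Fintype.card V : ℝ) ^ 2) := by
            rw [mul_pow, mul_pow, Real.sq_sqrt h0]; ring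
      · push Not at h2
        calc ((k : ℝ) + 1) ^ 2 ≤ (Fintype.card V : ℝ) ^ 2 := by gcongr
          _ ≤ (lam + 1 - c) * (100 * (Fintype.card V : ℝ) ^ 2) := by
            nlinarith [sq_nonneg (Fintype.card V : ℝ)]
    change c - 1 + ((k : ℝ) + 1) ^ 2 / (100 * (Fintype.card V : ℝ) ^ 2) ≤ lam
    linarith

end Spectrum

end SimpleGraph

theorem mainTheorem1 {V : Type*} (G : SimpleGraph V) [G.LocallyFinite] {d : ℕ}
    (hreg : G.IsRegularOfDegree d) (hconn : G.Connected) (hnb : ¬ G.IsBipartite) :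
    (∀ (x : V) (δ : ℝ), 0 ≤ δ → δ ≤ 2 → G.vertexSpectralMeasure x δ ≤ 10 * √δ) ∧
    (∀ [Fintype V] [DecidableEq V],
      (∃ lamQ : Fin (Fintype.card V) → ℝ,
        IsOrderedSpectrum (1 + G.transitionMatrix) lamQ ∧
        ∀ k : Fin (Fintype.card V),
          ((k : ℝ) + 1) ^ 2 / (100 * (Fintype.card V : ℝ) ^ 2) ≤ lamQ k) ∧
      (∃ lamP : Fin (Fintype.card V) → ℝ,
        IsOrderedSpectrum G.transitionMatrix lamP ∧
        ∀ k : Fin (Fintype.card V),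
          -1 + ((k : ℝ) + 1) ^ 2 / (100 * (Fintype.card V : ℝ) ^ 2) ≤ lamP k)) := by
  refine ⟨fun x δ h0 h2 => G.vertexSpectralMeasure_le hreg hconn hnb x h0 h2, ?_⟩
  intro _ _
  constructor
  · simpa using SimpleGraph.exists_isOrderedSpectrum hreg hconn hnb 1
  · simpa using SimpleGraph.exists_isOrderedSpectrum hreg hconn hnb 0
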